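/- Theorem 2.6 (\label{thm11}): Let $\mathcal{A}$ be a unital commutative C$^*$-algebra with spectrum (character space, with the weak-$*$ topology) $\sigma(\mathcal{A})$, let $\Phi:\mathcal{A}\to\mathcal{A}$ be an isometric $*$-isomorphism, and let $b=(b_j)_{j\in\mathbb{Z}}$ be a sequence of invertible elements of $\mathcal{A}$ with $\sup_{j\in\mathbb{Z}}\|b_j\|<\infty$ and $\sup_{j\in\mathbb{Z}}\|b_j^{-1}\|<\infty$. Let $\ell^2(\mathcal{A})$ be the standard Hilbert module, i.e. the space of all $a=(a_j)_{j\in\mathbb{Z}}$ in $\mathcal{A}$ such that $\sum_{j} a_j^*a_j$ converges in norm, with $\|a\|_2=\big\|\sum_{j} a_j^*a_j\big\|^{1/2}$, and for $n\in\mathbb{N}_0$ let $T_{\Phi,b,n}$ be the bounded operator on $\ell^2(\mathcal{A})$ given by $$\big(T_{\Phi,b,n}(a)\big)_j=\Big[\prod_{k=1}^{n}\Phi^{n-k}(b_{j-n+k})\Big]\,\Phi^n(a_{j-n})\qquad(j\in\mathbb{Z}).$$ Suppose that for every non-empty compact $K\subseteq\sigma(\mathcal{A})$ and every non-empty finite $I\subset\mathbb{N}=\{1,2,\dots\}$,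 $$\lim_{n\to\infty}\Big(\sup_{h\in K}\prod_{i=1}^{n}\big|h\big(\Phi^{-i}(b_{i+j})\big)\big|\Big)=\lim_{n\to\infty}\Big(\sup_{h\in K}\prod_{i=1}^{n}\big|h\big(\Phi^{i-1}(b_{j-i+1})\big)\big|^{-1}\Big)=0$$ for all $j\in I$. Then $(T_{\Phi,b,n})_{n\in\mathbb{N}_0}$ is topologically mixing: for all non-empty open $U,V\subseteq\ell^2(\mathcal{A})$ there is an $N$ such that $T_{\Phi,b,n}(U)\cap V\neq\varnothing$ for all $n\ge N$. -/

import Mathlib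

open Filter Topology

section StandardHilbertModule

variable {A : Type*} [CommCStarAlgebra A]

-- The finite partial sums of the squared norm satisfy the triangle inequality and the
-- boundedness under weights; everything about the infinite sums is deduced from this.

theorem sqrt_norm_sum_add_le (F : Finset ℤ) (x y : ℤ → A) :
    √‖∑ j ∈ F, star (x j + y j) * (x j + y j)‖ ≤
      √‖∑ j ∈ F, star (x j) * x j‖ + √‖∑ j ∈ F, star (y j) * y j‖ := by
  let _ : PartialOrder A := CStarAlgebra.spectralOrder A
  have _ : StarOrderedRing A := CStarAlgebra.spectralOrderedRing A
  let _ : NormedAddCommGroup (WithCStarModule A (F → A)) :=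
    CStarModule.normedAddCommGroup A
  have key : ∀ z : ℤ → A,
      ‖(WithCStarModule.equiv A (F → A)).symm (fun j => z j)‖ =
        √‖∑ j ∈ F, star (z j) * z j‖ := by
    intro z
    have h1 := WithCStarModule.pi_norm (A := A)
      ((WithCStarModule.equiv A (F → A)).symm (fun j => z j))
    refine h1.trans ?_
    congr 2
    rw [← Finset.sum_coe_sort F]
    refine Finset.sum_congr rfl fun j _ => ?_
    exact mul_comm _ _
  have h := norm_add_le ((WithCStarModule.equiv A (F → A)).symm (fun j : F => x j))
    ((WithCStarModule.equiv A (F → A)).symm (fun j : F => y j))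
  rw [← key x, ← key y, ← key (fun j => x j + y j)]
  exact h

theorem norm_sum_weight_le (F : Finset ℤ) (w x : ℤ → A) {C : ℝ} (hC : ∀ j, ‖w j‖ ≤ C) :
    ‖∑ j ∈ F, star (w j * x j) * (w j * x j)‖ ≤ C ^ 2 * ‖∑ j ∈ F, star (x j) * x j‖ := by
  let _ : PartialOrder A := CStarAlgebra.spectralOrder A
  have _ : StarOrderedRing A := CStarAlgebra.spectralOrderedRing A
  have hle : ∑ j ∈ F, star (w j * x j) * (w j * x j) ≤ C ^ 2 • ∑ j ∈ F, star (x j) * x j := by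
    rw [Finset.smul_sum]
    refine Finset.sum_le_sum fun j _ => ?_
    have h1 : star (w j * x j) * (w j * x j) = star (x j) * (star (w j) * w j) * x j := by
      rw [star_mul]; ring
    have h2 : star (x j) * (star (w j) * w j) * x j ≤
        ‖star (w j) * w j‖ • (star (x j) * x j) :=
      CStarAlgebra.star_left_conjugate_le_norm_smul (hb := IsSelfAdjoint.star_mul_self (w j))
    rw [h1]
    refine h2.trans (smul_le_smul_of_nonneg_right ?_ (star_mul_self_nonneg _))
    rw [CStarRing.norm_star_mul_self, pow_two]
    exact mul_self_le_mul_self (norm_nonneg _) (hC j)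
  have hnn : 0 ≤ ∑ j ∈ F, star (w j * x j) * (w j * x j) :=
    Finset.sum_nonneg fun j _ => star_mul_self_nonneg _
  refine (CStarAlgebra.norm_le_norm_of_nonneg_of_le hnn hle).trans ?_
  rw [norm_smul, Real.norm_of_nonneg (sq_nonneg C)]

theorem summable_add_aux {x y : ℤ → A} (hx : Summable fun j => star (x j) * x j)
    (hy : Summable fun j => star (y j) * y j) :
    Summable fun j => star (x j + y j) * (x j + y j) := by
  rw [summable_iff_vanishing_norm] at hx hy ⊢
  intro ε hε
  obtain ⟨s, hs⟩ := hx (ε / 4) (by positivity)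
  obtain ⟨t, ht⟩ := hy (ε / 4) (by positivity)
  refine ⟨s ∪ t, fun F hF => ?_⟩
  rw [Finset.disjoint_union_right] at hF
  have h1 := hs F hF.1
  have h2 := ht F hF.2
  have h3 := sqrt_norm_sum_add_le F x y
  have e1 := Real.sqrt_lt_sqrt (norm_nonneg _) h1
  have e2 := Real.sqrt_lt_sqrt (norm_nonneg _) h2
  rw [← Real.sqrt_lt_sqrt_iff (norm_nonneg _)]
  have h4 : √ε = 2 * √(ε / 4) := by
    rw [show ε = 2 ^ 2 * (ε / 4) by ring, Real.sqrt_mul (by positivity),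
      Real.sqrt_sq (by norm_num)]
    congr 3; ring
  rw [h4]; linarith

theorem summable_weight_aux {w x : ℤ → A} {C : ℝ} (hC : ∀ j, ‖w j‖ ≤ C)
    (hx : Summable fun j => star (x j) * x j) :
    Summable fun j => star (w j * x j) * (w j * x j) := by
  rw [summable_iff_vanishing_norm] at hx ⊢
  intro ε hε
  obtain ⟨s, hs⟩ := hx (ε / (C ^ 2 + 1)) (by positivity)
  refine ⟨s, fun F hF => (norm_sum_weight_le F w x hC).trans_lt ?_⟩
  have h1 := hs F hF
  rw [lt_div_iff₀ (by positivity)] at h1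
  nlinarith [norm_nonneg (∑ j ∈ F, star (x j) * x j)]

variable (A) in
/-- The sequences `(a_j)_{j ∈ ℤ}` in `A` for which `∑ a_j^* a_j` converges in norm,
as an `A`-submodule of the space of all sequences. -/
def l2Submodule : Submodule A (ℤ → A) where
  carrier := {a | Summable fun j => star (a j) * a j}
  zero_mem' := by simp
  add_mem' := fun ha hb => summable_add_aux ha hb
  smul_mem' := fun c _ ha => summable_weight_aux (w := fun _ => c) (fun _ => le_rfl) ha

variable (A) in
/-- The standard Hilbert module `ℓ²(A)` over `A`, indexed by `ℤ`. It is a type synonym, so that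
its topology is the one of its norm and not the one of pointwise convergence. -/
def L2 : Type _ := l2Submodule A

namespace L2

noncomputable instance : AddCommGroup (L2 A) := inferInstanceAs (AddCommGroup (l2Submodule A))
noncomputable instance : Module A (L2 A) := inferInstanceAs (Module A (l2Submodule A))
noncomputable instance : Module ℂ (L2 A) := inferInstanceAs (Module ℂ (l2Submodule A))

instance : CoeFun (L2 A) (fun _ => ℤ → A) := ⟨fun a => a.1⟩

theorem summable (a : L2 A) : Summable fun j => star (a j) * a j := a.2

@[ext] theorem ext {a b : L2 A} (h : ∀ j, a j = b j) : a = b := Subtype.ext (funext h)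

@[simp] theorem zero_apply (j : ℤ) : (0 : L2 A) j = 0 := rfl
@[simp] theorem add_apply (a b : L2 A) (j : ℤ) : (a + b) j = a j + b j := rfl
@[simp] theorem neg_apply (a : L2 A) (j : ℤ) : (-a) j = -a j := rfl
@[simp] theorem smul_apply (c : ℂ) (a : L2 A) (j : ℤ) : (c • a) j = c • a j := rfl

/-- `‖a‖₂ = ‖∑ a_j^* a_j‖^{1/2}`. -/
noncomputable instance : Norm (L2 A) := ⟨fun a => √‖∑' j, star (a j) * a j‖⟩

theorem norm_def (a : L2 A) : ‖a‖ = √‖∑' j, star (a j) * a j‖ := rfl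

theorem tendsto_norm (a : L2 A) :
    Tendsto (fun F : Finset ℤ => √‖∑ j ∈ F, star (a j) * a j‖) atTop (𝓝 ‖a‖) :=
  (Real.continuous_sqrt.tendsto _).comp a.summable.hasSum.norm

theorem norm_coord_le (a : L2 A) (j : ℤ) : ‖a j‖ ≤ ‖a‖ := by
  let _ : PartialOrder A := CStarAlgebra.spectralOrder A
  have _ : StarOrderedRing A := CStarAlgebra.spectralOrderedRing A
  refine ge_of_tendsto a.tendsto_norm ?_
  filter_upwards [eventually_ge_atTop {j}] with F hF
  refine Real.le_sqrt_of_sq_le ?_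
  rw [pow_two, ← CStarRing.norm_star_mul_self]
  refine CStarAlgebra.norm_le_norm_of_nonneg_of_le (star_mul_self_nonneg _) ?_
  exact Finset.single_le_sum (f := fun j => star (a j) * a j)
    (fun i _ => star_mul_self_nonneg _) (hF (Finset.mem_singleton_self j))

noncomputable instance : NormedAddCommGroup (L2 A) :=
  AddGroupNorm.toNormedAddCommGroup
    { toFun := fun a => ‖a‖
      map_zero' := by simp [norm_def]
      add_le' := fun a b => le_of_tendsto_of_tendsto' (a + b).tendsto_norm
        (a.tendsto_norm.add b.tendsto_norm) fun F => sqrt_norm_sum_add_le F a b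
      neg' := fun a => by simp [norm_def]
      eq_zero_of_map_eq_zero' := fun a ha => by
        ext j
        have h := a.norm_coord_le j
        rw [show ‖a‖ = 0 from ha] at h
        exact norm_le_zero_iff.mp h }

noncomputable instance : NormedSpace ℂ (L2 A) where
  norm_smul_le := fun c a => by
    refine le_of_eq ?_
    have h : ∀ j, star ((c • a) j) * (c • a) j = (star c * c) • (star (a j) * a j) := fun j => by
      rw [smul_apply, star_smul, smul_mul_smul_comm]
    rw [norm_def, norm_def, tsum_congr h, tsum_const_smul'', norm_smul,
      CStarRing.norm_star_mul_self, Real.sqrt_mul (by positivity), Real.sqrt_mul_self (by positivity)]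

end L2

/-- The `j`-th weight `∏_{k=1}^n Φ^{n-k}(b_{j-n+k})` of the `n`-th generalized shift. -/
noncomputable def shiftWeight (Φ : A ≃⋆ₐ[ℂ] A) (b : ℤ → A) (n : ℕ) (j : ℤ) : A :=
  ∏ k ∈ Finset.Icc 1 n, (Φ ^ (n - k)) (b (j - n + k))

theorem exists_norm_shiftWeight_le (Φ : A ≃⋆ₐ[ℂ] A) (b : ℤ → A)
    (hb : BddAbove (Set.range fun j => ‖b j‖)) (n : ℕ) :
    ∃ C : ℝ, ∀ j, ‖shiftWeight Φ b n j‖ ≤ C := by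
  obtain ⟨M, hM⟩ := hb
  have hM' : ∀ j, ‖b j‖ ≤ M := fun j => hM ⟨j, rfl⟩
  refine ⟨‖(1 : A)‖ * M ^ n, fun j => ?_⟩
  have key : ∀ s : Finset ℕ,
      ‖∏ k ∈ s, (Φ ^ (n - k)) (b (j - n + k))‖ ≤ ‖(1 : A)‖ * M ^ s.card := by
    intro s
    induction s using Finset.induction_on with
    | empty => simp
    | insert i s hi ih =>
      rw [Finset.prod_insert hi, Finset.card_insert_of_notMem hi]
      refine (norm_mul_le _ _).trans ?_
      rw [StarAlgEquiv.norm_map, pow_succ]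
      have := mul_le_mul (hM' (j - n + i)) ih (norm_nonneg _) ((norm_nonneg _).trans (hM' 0))
      linarith
  simpa [shiftWeight] using key (Finset.Icc 1 n)

theorem hasSum_shift_aux (Φ : A ≃⋆ₐ[ℂ] A) (n : ℕ) (a : L2 A) :
    HasSum (fun j : ℤ => star ((Φ ^ n) (a (j - n))) * (Φ ^ n) (a (j - n)))
      ((Φ ^ n) (∑' j, star (a j) * a j)) := by
  have hcont : Continuous (Φ ^ n) := (StarAlgEquiv.isometry (Φ ^ n)).continuous
  have h := (a.summable.hasSum.map (Φ ^ n) hcont)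
  have h2 := (Equiv.subRight (n : ℤ)).hasSum_iff.mpr h
  refine h2.congr_fun ?_
  intro j
  change star ((Φ ^ n) (a (j - n))) * (Φ ^ n) (a (j - n)) =
    (Φ ^ n) (star (a (j - n)) * a (j - n))
  rw [map_mul, map_star]

/-- The generalized bilateral shift `T_{Φ,b,n}` as a bounded operator on `ℓ²(A)`:
`(T_{Φ,b,n} a)_j = [∏_{k=1}^n Φ^{n-k}(b_{j-n+k})] Φ^n(a_{j-n})`. -/
noncomputable def genShift (Φ : A ≃⋆ₐ[ℂ] A) (b : ℤ → A)
    (hb : BddAbove (Set.range fun j => ‖b j‖)) (n : ℕ) : L2 A →L[ℂ] L2 A :=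
  LinearMap.mkContinuousOfExistsBound
    { toFun := fun a =>
        ⟨fun j => shiftWeight Φ b n j * (Φ ^ n) (a (j - n)),
          summable_weight_aux (exists_norm_shiftWeight_le Φ b hb n).choose_spec
            (hasSum_shift_aux Φ n a).summable⟩
      map_add' := fun a a' => by
        ext j
        change shiftWeight Φ b n j * (Φ ^ n) (a (j - n) + a' (j - n)) =
          shiftWeight Φ b n j * (Φ ^ n) (a (j - n)) + shiftWeight Φ b n j * (Φ ^ n) (a' (j - n))
        rw [map_add, mul_add]
      map_smul' := fun c a => by
        ext j
        change shiftWeight Φ b n j * (Φ ^ n) (c • a (j - n)) =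
          c • (shiftWeight Φ b n j * (Φ ^ n) (a (j - n)))
        rw [map_smul, mul_smul_comm] }
    (by
      obtain ⟨C, hC⟩ := exists_norm_shiftWeight_le Φ b hb n
      have hC0 : 0 ≤ C := (norm_nonneg _).trans (hC 0)
      refine ⟨C, fun a => ?_⟩
      have hs := hasSum_shift_aux Φ n a
      have h1 := (Real.continuous_sqrt.tendsto _).comp hs.norm
      rw [StarAlgEquiv.norm_map] at h1
      refine le_of_tendsto_of_tendsto' (L2.tendsto_norm _) (h1.const_mul C) fun F => ?_
      have h2 := norm_sum_weight_le F (shiftWeight Φ b n) (fun j => (Φ ^ n) (a (j - n))) hC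
      refine (Real.sqrt_le_sqrt h2).trans ?_
      rw [Real.sqrt_mul (sq_nonneg C), Real.sqrt_sq hC0]
      rfl)

theorem genShift_apply (Φ : A ≃⋆ₐ[ℂ] A) (b : ℤ → A)
    (hb : BddAbove (Set.range fun j => ‖b j‖)) (n : ℕ) (a : L2 A) (j : ℤ) :
    genShift Φ b hb n a j =
      (∏ k ∈ Finset.Icc 1 n, (Φ ^ (n - k)) (b (j - n + k))) * (Φ ^ n) (a (j - n)) := rfl

end StandardHilbertModule

/-- A sequence of bounded operators is topologically mixing if for all non-empty open `U`, `V`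
one has `T_n(U) ∩ V ≠ ∅` from some `n` onwards. -/
def TopologicallyMixing {X : Type*} [NormedAddCommGroup X] [NormedSpace ℂ X]
    (T : ℕ → X →L[ℂ] X) : Prop :=
  ∀ U V : Set X, IsOpen U → IsOpen V → U.Nonempty → V.Nonempty →
    ∃ N : ℕ, ∀ n : ℕ, N ≤ n → (T n '' U ∩ V).Nonempty

section MixingOfWeights

variable {A : Type*} [CommCStarAlgebra A]

/-! Write `W n j` for `shiftWeight Φ b n j`. The character space is compact and the Gelfand
transform isometric, so for `K` the whole space the suprema in the hypothesis are norms: `‖W n (j +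
n)‖ → 0` and `‖(W n j)⁻¹‖ → 0` for `j ≥ 1`. Recursions for `W` and the bound on `b` carry both
limits down to all integers `j`.

The shift sends the entry `x` at `m` to the entry `W n (m + n) * Φ^n x` at `m + n`, so the first
limit makes the orbits of finitely supported sequences tend to zero. The second does the same for
right inverses, which move entries from `m` to `m - n`. As these sequences are dense, the criterion
`TopologicallyMixing.of_dense` applies. -/

theorem norm_eq_iSup_characterSpace (x : A) :
    ‖x‖ = ⨆ h : (Set.univ : Set (WeakDual.characterSpace ℂ A)), ‖h.1 x‖ := by
  have h1 : ‖WeakDual.gelfandTransform ℂ A x‖ = ‖x‖ :=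
    (gelfandTransform_isometry A).norm_map_of_map_zero (map_zero _) x
  rw [← h1, ContinuousMap.norm_eq_iSup_norm]
  exact ((Equiv.Set.univ (WeakDual.characterSpace ℂ A)).iSup_congr fun _ => rfl).symm

/-! ### Recursions, product formulas and limits of the weights -/

theorem shiftWeight_succ (Φ : A ≃⋆ₐ[ℂ] A) (b : ℤ → A) (n : ℕ) (j : ℤ) :
    shiftWeight Φ b (n + 1) j = (Φ ^ n) (b (j - n)) * shiftWeight Φ b n j := by
  simp only [shiftWeight, ← Finset.Ico_add_one_right_eq_Icc]
  rw [Finset.prod_eq_prod_Ico_succ_bot (by omega), ← Finset.prod_Ico_add' _ 1 (n + 1) 1]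
  congr 1
  · congr 2
    push_cast
    ring
  · refine Finset.prod_congr rfl fun k _ => ?_
    rw [Nat.add_sub_add_right]
    congr 2
    push_cast
    ring

theorem shiftWeight_succ' (Φ : A ≃⋆ₐ[ℂ] A) (b : ℤ → A) (n : ℕ) (j : ℤ) :
    shiftWeight Φ b (n + 1) (j + 1) = b (j + 1) * Φ (shiftWeight Φ b n j) := by
  simp only [shiftWeight]
  rw [Finset.prod_Icc_succ_top (by omega), mul_comm, map_prod]
  congr 1
  · rw [Nat.sub_self, pow_zero]
    change b _ = b _
    congr 1
    push_cast
    ring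
  · refine Finset.prod_congr rfl fun k hk => ?_
    rw [Nat.succ_sub (Finset.mem_Icc.mp hk).2, pow_succ']
    change Φ ((Φ ^ (n - k)) _) = Φ ((Φ ^ (n - k)) _)
    congr 3
    push_cast
    ring

theorem shiftWeight_eq_prod (Φ : A ≃⋆ₐ[ℂ] A) (b : ℤ → A) (n : ℕ) (j : ℤ) :
    shiftWeight Φ b n j = ∏ i ∈ Finset.Icc 1 n, (Φ ^ (i - 1)) (b (j - i + 1)) := by
  induction n with
  | zero => rfl
  | succ n ih =>
    rw [shiftWeight_succ, Finset.prod_Icc_succ_top (by omega), ih, mul_comm]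
    congr 3
    push_cast
    ring

/-- Since `Φ ^ n` is isometric, the norm of this weight is that of the product in the first limit of
the hypothesis. -/
theorem shiftWeight_add_eq_prod (Φ : A ≃⋆ₐ[ℂ] A) (b : ℤ → A) (n : ℕ) (j : ℤ) :
    shiftWeight Φ b n (j + n) =
      (Φ ^ n) (∏ i ∈ Finset.Icc 1 n, (Φ ^ (-(i : ℤ))) (b (i + j))) := by
  rw [shiftWeight, map_prod]
  refine Finset.prod_congr rfl fun k hk => ?_
  have h : Φ ^ (n - k) = Φ ^ n * Φ ^ (-(k : ℤ)) := by
    rw [← zpow_natCast, ← zpow_natCast, ← zpow_add, Nat.cast_sub (Finset.mem_Icc.mp hk).2,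
      sub_eq_add_neg]
  rw [h]
  change (Φ ^ n) ((Φ ^ (-(k : ℤ))) _) = (Φ ^ n) ((Φ ^ (-(k : ℤ))) _)
  congr 3
  ring

theorem isUnit_shiftWeight (Φ : A ≃⋆ₐ[ℂ] A) {b : ℤ → A} (hunit : ∀ j, IsUnit (b j))
    (n : ℕ) (j : ℤ) : IsUnit (shiftWeight Φ b n j) :=
  Submonoid.prod_mem (IsUnit.submonoid A) fun k _ => (hunit (j - n + k)).map (Φ ^ (n - k))

/-- The identity `W (n + 1) (j - 1 + (n + 1)) = Φ^n (b j) * W n (j + n)` passes the limit from `j`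
to `j - 1`, at the cost of a factor bounded by `sup ‖b j‖`. -/
theorem tendsto_norm_shiftWeight_add (Φ : A ≃⋆ₐ[ℂ] A) {b : ℤ → A}
    (hb : BddAbove (Set.range fun j => ‖b j‖))
    (h : ∀ j : ℕ, 1 ≤ j → Tendsto (fun n : ℕ => ‖shiftWeight Φ b n (j + n)‖) atTop (𝓝 0))
    (j : ℤ) : Tendsto (fun n : ℕ => ‖shiftWeight Φ b n (j + n)‖) atTop (𝓝 0) := by
  obtain ⟨M, hM⟩ := hb
  rcases lt_or_ge j 1 with hj | hj
  · refine Int.leInductionDown (m := 1)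
      (motive := fun j _ => Tendsto (fun n : ℕ => ‖shiftWeight Φ b n (j + n)‖) atTop (𝓝 0))
      (mod_cast h 1 le_rfl) (fun j _ ih => ?_) j hj.le
    rw [← tendsto_add_atTop_iff_nat 1]
    refine squeeze_zero (fun _ => norm_nonneg _) (fun n => ?_) (by simpa using ih.const_mul M)
    have e : j - 1 + ((n + 1 : ℕ) : ℤ) = j + n := by push_cast; ring
    rw [e, shiftWeight_succ]
    refine (norm_mul_le _ _).trans ?_
    rw [StarAlgEquiv.norm_map]
    exact mul_le_mul_of_nonneg_right (hM ⟨_, rfl⟩) (norm_nonneg _)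
  · lift j to ℕ using by omega
    exact h j (by omega)

/-- Inverting `W (n + 1) j = b j * Φ (W n (j - 1))` leaves `b j`, not its inverse, as the factor in
the step from `j` to `j - 1`. -/
theorem tendsto_norm_inverse_shiftWeight (Φ : A ≃⋆ₐ[ℂ] A) {b : ℤ → A}
    (hb : BddAbove (Set.range fun j => ‖b j‖)) (hunit : ∀ j, IsUnit (b j))
    (h : ∀ j : ℕ, 1 ≤ j →
      Tendsto (fun n : ℕ => ‖Ring.inverse (shiftWeight Φ b n j)‖) atTop (𝓝 0))
    (j : ℤ) : Tendsto (fun n : ℕ => ‖Ring.inverse (shiftWeight Φ b n j)‖) atTop (𝓝 0) := by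
  obtain ⟨M, hM⟩ := hb
  rcases lt_or_ge j 1 with hj | hj
  · refine Int.leInductionDown (m := 1)
      (motive := fun j _ => Tendsto (fun n : ℕ => ‖Ring.inverse (shiftWeight Φ b n j)‖)
        atTop (𝓝 0))
      (mod_cast h 1 le_rfl) (fun j _ ih => ?_) j hj.le
    refine squeeze_zero (fun _ => norm_nonneg _) (fun n => ?_)
      (by simpa using ((tendsto_add_atTop_iff_nat 1).mpr ih).const_mul M)
    have key : Φ (Ring.inverse (shiftWeight Φ b n (j - 1))) =
        b j * Ring.inverse (shiftWeight Φ b (n + 1) j) := by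
      have e := shiftWeight_succ' Φ b n (j - 1)
      rw [sub_add_cancel] at e
      have h1 := Ring.mul_inverse_cancel _ (isUnit_shiftWeight Φ hunit (n + 1) j)
      have h2 : Φ (shiftWeight Φ b n (j - 1)) * Φ (Ring.inverse (shiftWeight Φ b n (j - 1))) = 1 := by
        rw [← map_mul, Ring.mul_inverse_cancel _ (isUnit_shiftWeight Φ hunit n (j - 1)), map_one]
      rw [e] at h1 ⊢
      -- Uniqueness of inverses: both sides are inverse to `Φ (W n (j - 1))`.
      linear_combination (b j * Ring.inverse (b j * Φ (shiftWeight Φ b n (j - 1)))) * h2 -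
        Φ (Ring.inverse (shiftWeight Φ b n (j - 1))) * h1
    rw [← StarAlgEquiv.norm_map Φ, key]
    exact (norm_mul_le _ _).trans (mul_le_mul_of_nonneg_right (hM ⟨_, rfl⟩) (norm_nonneg _))
  · lift j to ℕ using by omega
    exact h j (by omega)

/-! ### Finitely supported sequences -/

namespace L2

/-- The sequence with the entry `x` at `m` and zeros elsewhere. -/
noncomputable def single (m : ℤ) (x : A) : L2 A :=
  ⟨Pi.single m x, summable_of_ne_finset_zero (s := {m}) fun j hj => by
    rw [Pi.single_eq_of_ne (by simpa using hj), mul_zero]⟩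

theorem single_apply (m : ℤ) (x : A) (j : ℤ) : single m x j = if j = m then x else 0 :=
  Pi.single_apply m x j

theorem norm_single (m : ℤ) (x : A) : ‖single m x‖ = ‖x‖ := by
  rw [norm_def, tsum_eq_single m fun j hj => by rw [single_apply, if_neg hj, mul_zero],
    single_apply, if_pos rfl, CStarRing.norm_star_mul_self, Real.sqrt_mul_self (norm_nonneg _)]

theorem sum_apply {ι : Type*} (s : Finset ι) (f : ι → L2 A) (j : ℤ) :
    (∑ i ∈ s, f i) j = ∑ i ∈ s, f i j := by
  induction s using Finset.cons_induction with
  | empty => rfl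
  | cons i s hi ih => rw [Finset.sum_cons, Finset.sum_cons, add_apply, ih]

/-- The squared norm of the error of a partial sum is the norm of a tail of the convergent series `∑
a_j^* a_j`. -/
theorem hasSum_single (a : L2 A) : HasSum (fun j => single j (a j)) a := by
  have happ : ∀ (F : Finset ℤ) (j : ℤ),
      (∑ i ∈ F, single i (a i) - a) j = if j ∈ F then 0 else -a j := fun F j => by
    rw [sub_eq_add_neg, add_apply, neg_apply, sum_apply]
    simp only [single_apply, Finset.sum_ite_eq]
    split_ifs <;> simp
  have hnorm : ∀ F : Finset ℤ, ‖∑ i ∈ F, single i (a i) - a‖ =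
      √‖∑ i ∈ F, star (a i) * a i - ∑' i, star (a i) * a i‖ := fun F => by
    rw [norm_def, ← norm_neg (∑ i ∈ F, star (a i) * a i - _), neg_sub]
    congr 2
    refine HasSum.tsum_eq ?_
    have h := a.summable.hasSum.sub (hasSum_sum_of_ne_finset_zero (s := F)
      (f := fun j => if j ∈ F then star (a j) * a j else 0) fun j hj => if_neg hj)
    rw [Finset.sum_congr rfl fun j hj => if_pos hj] at h
    refine h.congr_fun fun j => ?_
    rw [happ]
    split_ifs <;> simp
  rw [HasSum, SummationFilter.unconditional_filter, tendsto_iff_norm_sub_tendsto_zero]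
  simp only [hnorm]
  simpa using (tendsto_iff_norm_sub_tendsto_zero.mp a.summable.hasSum).sqrt

/-- The dense set is an additive closure, so that properties stable under sums need checking only on
single entries. -/
theorem dense_closure_single :
    Dense (AddSubmonoid.closure {a : L2 A | ∃ m x, a = single m x} : Set (L2 A)) := fun a =>
  mem_closure_of_tendsto a.hasSum_single <| Eventually.of_forall fun _ =>
    AddSubmonoid.sum_mem _ fun j _ => AddSubmonoid.subset_closure ⟨j, _, rfl⟩

end L2

/-! ### Mixing of the shifts -/

theorem genShift_single (Φ : A ≃⋆ₐ[ℂ] A) (b : ℤ → A)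
    (hb : BddAbove (Set.range fun j => ‖b j‖)) (n : ℕ) (m : ℤ) (x : A) :
    genShift Φ b hb n (L2.single m x) =
      L2.single (m + n) (shiftWeight Φ b n (m + n) * (Φ ^ n) x) := by
  ext j
  rw [genShift_apply, L2.single_apply, L2.single_apply]
  by_cases h : j = m + n
  · subst h
    rw [if_pos (by ring), if_pos rfl]
    rfl
  · rw [if_neg (by omega), if_neg h, map_zero, mul_zero]

/-- A form of the mixing criterion: `T n → 0` pointwise on a dense set, on which the `T n` also
have right inverses that tend to `0` pointwise. -/
theorem TopologicallyMixing.of_dense {X : Type*} [NormedAddCommGroup X] [NormedSpace ℂ X]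
    {T : ℕ → X →L[ℂ] X} {D : Set X} (hD : Dense D)
    (hT : ∀ u ∈ D, Tendsto (fun n => T n u) atTop (𝓝 0))
    (hS : ∀ v ∈ D, ∃ s : ℕ → X, (∀ n, T n (s n) = v) ∧ Tendsto s atTop (𝓝 0)) :
    TopologicallyMixing T := by
  intro U V hU hV hU' hV'
  obtain ⟨u, huU, huD⟩ := hD.inter_open_nonempty U hU hU'
  obtain ⟨v, hvV, hvD⟩ := hD.inter_open_nonempty V hV hV'
  obtain ⟨s, hs, hs0⟩ := hS v hvD
  -- The witness `u + s n` is close to `u`, while its image `T n u + v` is close to `v`.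
  have h1 : ∀ᶠ n in atTop, u + s n ∈ U :=
    (by simpa using hs0.const_add u : Tendsto (fun n => u + s n) atTop (𝓝 u)).eventually_mem
      (hU.mem_nhds huU)
  have h2 : ∀ᶠ n in atTop, T n u + v ∈ V :=
    (by simpa using (hT u huD).add_const v :
      Tendsto (fun n => T n u + v) atTop (𝓝 v)).eventually_mem (hV.mem_nhds hvV)
  obtain ⟨N, hN⟩ := eventually_atTop.mp (h1.and h2)
  exact ⟨N, fun n hn => ⟨T n (u + s n), ⟨_, (hN n hn).1, rfl⟩, by
    rw [map_add, hs]; exact (hN n hn).2⟩⟩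

theorem topologicallyMixing_genShift (Φ : A ≃⋆ₐ[ℂ] A) (b : ℤ → A)
    (hb : BddAbove (Set.range fun j => ‖b j‖)) (hunit : ∀ j, IsUnit (b j))
    (h1 : ∀ j : ℤ, Tendsto (fun n : ℕ => ‖shiftWeight Φ b n (j + n)‖) atTop (𝓝 0))
    (h2 : ∀ j : ℤ, Tendsto (fun n : ℕ => ‖Ring.inverse (shiftWeight Φ b n j)‖) atTop (𝓝 0)) :
    TopologicallyMixing (genShift Φ b hb) := by
  refine .of_dense L2.dense_closure_single (fun u hu => ?_) fun v hv => ?_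
  · induction hu using AddSubmonoid.closure_induction with
    | mem u hu =>
      obtain ⟨m, x, rfl⟩ := hu
      refine squeeze_zero_norm (fun n => ?_) (by simpa using (h1 m).mul_const ‖x‖)
      rw [genShift_single, L2.norm_single]
      exact (norm_mul_le _ _).trans_eq (by rw [StarAlgEquiv.norm_map])
    | zero => simp
    | add u v _ _ hu hv => simpa using hu.add hv
  · induction hv using AddSubmonoid.closure_induction with
    | mem v hv =>
      obtain ⟨m, x, rfl⟩ := hv
      -- The shift brings the entry back to `m`, where the factor `W n m` cancels the inverse
      -- weight.
      refine ⟨fun n => L2.single (m - n)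
        ((Φ ^ n).symm (Ring.inverse (shiftWeight Φ b n m) * x)), fun n => ?_, ?_⟩
      · rw [genShift_single, sub_add_cancel, StarAlgEquiv.apply_symm_apply, ← mul_assoc,
          Ring.mul_inverse_cancel _ (isUnit_shiftWeight Φ hunit n m), one_mul]
      · refine squeeze_zero_norm (fun n => ?_) (by simpa using (h2 m).mul_const ‖x‖)
        rw [L2.norm_single, StarAlgEquiv.norm_map]
        exact norm_mul_le _ _
    | zero => exact ⟨0, by simp, tendsto_const_nhds⟩
    | add v w _ _ hv hw =>
      obtain ⟨s, hs, hs0⟩ := hv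
      obtain ⟨t, ht, ht0⟩ := hw
      exact ⟨fun n => s n + t n, fun n => by rw [map_add, hs, ht], by simpa using hs0.add ht0⟩

end MixingOfWeights

theorem theorem2p6 {A : Type*} [CommCStarAlgebra A] (Φ : A ≃⋆ₐ[ℂ] A) (b : ℤ → A)
    (hb : BddAbove (Set.range fun j => ‖b j‖))
    (hunit : ∀ j, IsUnit (b j))
    (hinv : BddAbove (Set.range fun j => ‖Ring.inverse (b j)‖))
    (hweights : ∀ K : Set (WeakDual.characterSpace ℂ A), K.Nonempty → IsCompact K →
      ∀ I : Finset ℕ, I.Nonempty → (∀ j ∈ I, 1 ≤ j) → ∀ j ∈ I,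
        Tendsto (fun n : ℕ => ⨆ h : K, ∏ i ∈ Finset.Icc 1 n,
          ‖h.1 ((Φ ^ (-(i : ℤ))) (b ((i : ℤ) + (j : ℤ))))‖) atTop (𝓝 0) ∧
        Tendsto (fun n : ℕ => ⨆ h : K, ∏ i ∈ Finset.Icc 1 n,
          ‖h.1 ((Φ ^ (i - 1)) (b ((j : ℤ) - (i : ℤ) + 1)))‖⁻¹) atTop (𝓝 0)) :
    TopologicallyMixing (genShift Φ b hb) := by
  -- The zero algebra has no characters, so the hypothesis says nothing there; but all norms vanish.
  rcases subsingleton_or_nontrivial A with hA | hA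
  · have h0 : ∀ x : A, ‖x‖ = 0 := fun x => by rw [Subsingleton.elim x 0, norm_zero]
    exact topologicallyMixing_genShift Φ b hb hunit (fun j => by simp [h0])
      fun j => by simp [h0]
  have hw : ∀ j : ℕ, 1 ≤ j → _ := fun j hj =>
    hweights Set.univ Set.univ_nonempty isCompact_univ {j} (Finset.singleton_nonempty j)
      (by simpa using hj) j (Finset.mem_singleton_self j)
  refine topologicallyMixing_genShift Φ b hb hunit
    (tendsto_norm_shiftWeight_add Φ hb fun j hj => (hw j hj).1.congr fun n => ?_)
    (tendsto_norm_inverse_shiftWeight Φ hb hunit fun j hj => (hw j hj).2.congr fun n => ?_)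
  · rw [shiftWeight_add_eq_prod, StarAlgEquiv.norm_map, norm_eq_iSup_characterSpace]
    simp only [map_prod, norm_prod]
  · rw [norm_eq_iSup_characterSpace]
    refine iSup_congr fun h => ?_
    -- Characters are multiplicative, so `h` of the inverse weight is the inverse of `h` of the
    -- weight.
    have h1 : h.1 (shiftWeight Φ b n j) * h.1 (Ring.inverse (shiftWeight Φ b n j)) = 1 := by
      rw [← map_mul, Ring.mul_inverse_cancel _ (isUnit_shiftWeight Φ hunit n j), map_one]
    rw [eq_inv_of_mul_eq_one_right h1, norm_inv, shiftWeight_eq_prod, map_prod, norm_prod,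
      Finset.prod_inv_distrib]
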